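/- Let $b>1$ be an integer and let $A\subset\{0,1,\dots,b-1\}$ be a set containing at least one non-zero element. Put $A_1=A\setminus\{0\}$, $N=\#A$ and $s_0=\log_b N$. Call an integer $n>0$ admissible if all its base-$b$ digits belong to $A$. For $\Re s>s_0$ let $$K(s)=\sum_{n>0,\ n\text{ admissible}} n^{-s},\qquad u_m(s)=0^m+\sum_{l=1}^\infty\ \sum_{(a_1,\dots,a_l)\in A^l}\bigl(a_1b^{-1}+\dots+a_lb^{-l}\bigr)^m\,b^{-ls}\quad(m\ge 0),$$ where $0^0=1$; these series converge in that half-plane. Let $\alpha(s)=\prod_{n=0}^\infty(1-b^{-s-n}N)$; this product converges for every $s\in\mathbb C$ and $\alpha$ is an entire function. Write $(s)_m=s(s+1)\cdots(s+m-1)$. Each $u_m$ extends to a meromorphic function on $\mathbb C$, still denoted $u_m$, which is analytic outside the zeros of $\alpha$, and each $\alpha u_m$ extends to an entire function. The series, whose terms are entire functions, $$\sum_{m=0}^\infty(-1)^m\frac{(s)_m}{m!}\,\alpha(s)u_m(s)\sum_{a_1\in A_1,\ a_2\in A}(a_1b+a_2)^{-s-m}$$ converges at every $s\in\mathbb C$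 and its sum is an entire function of $s$, equal to $\alpha(s)\bigl(K(s)-\sum_{a\in A_1}a^{-s}\bigr)$ for $\Re s>s_0$; thus it gives the analytic continuation of the latter function. Consequently $K$ extends to a meromorphic function on $\mathbb C$, all of whose poles are simple and located at zeros of $\alpha$. -/

import Mathlib

open scoped BigOperators

noncomputable section

namespace RestrictedDirichlet

/-- All base-`b` digits of `n` (minimal representation) belong to `A`. -/
def Admissible (b : ℕ) (A : Finset ℕ) (n : ℕ) : Prop :=
  ∀ d ∈ Nat.digits b n, d ∈ A

open Classical in
/-- The indicator sequence of the admissible integers. Its value at `0` plays no role, as a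
Dirichlet series only involves positive indices. -/
def coeff (b : ℕ) (A : Finset ℕ) (n : ℕ) : ℂ :=
  if Admissible b A n then 1 else 0

/-- The restricted Dirichlet series, the sum of `n ^ (-s)` over the admissible `n > 0`. -/
def K (b : ℕ) (A : Finset ℕ) (s : ℂ) : ℂ :=
  LSeries (coeff b A) s

/-- The real number `log_b N`, where `N` is the number of admissible digits. -/
def s₀ (b : ℕ) (A : Finset ℕ) : ℝ :=
  Real.logb b A.card

/-- The sum of `(a₁ / b + ⋯ + a_l / b ^ l) ^ m * b ^ (-l s)` over all words
`(a₁, …, a_l)` of length `l` with letters in `A`. -/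
def uBlock (b : ℕ) (A : Finset ℕ) (m l : ℕ) (s : ℂ) : ℂ :=
  ∑ a ∈ Fintype.piFinset (fun _ : Fin l => A),
    (∑ i : Fin l, (a i : ℂ) / (b : ℂ) ^ ((i : ℕ) + 1)) ^ m * (b : ℂ) ^ (-((l : ℂ) * s))

/-- The defining series of `u_m(s)`: `0 ^ m` plus the sum of the blocks of lengths
`l = 1, 2, 3, …`. -/
def u (b : ℕ) (A : Finset ℕ) (m : ℕ) (s : ℂ) : ℂ :=
  (0 : ℂ) ^ m + ∑' l : ℕ, uBlock b A m (l + 1) s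

/-- The factor `1 - b ^ (-s - n) * N`. -/
def αFactor (b : ℕ) (A : Finset ℕ) (s : ℂ) (n : ℕ) : ℂ :=
  1 - (b : ℂ) ^ (-s - (n : ℂ)) * (A.card : ℂ)

/-- The infinite product of the factors `1 - b ^ (-s - n) * N` over `n = 0, 1, 2, …`. -/
def α (b : ℕ) (A : Finset ℕ) (s : ℂ) : ℂ :=
  ∏' n : ℕ, αFactor b A s n

/-- The sum of `a ^ (-s)` over the nonzero admissible digits `a`. -/
def digitSum (A : Finset ℕ) (s : ℂ) : ℂ :=
  ∑ a ∈ A.erase 0, (a : ℂ) ^ (-s)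

/-- The sum of `(a₁ b + a₂) ^ (-s - m)` over digits `a₁ ≠ 0` and `a₂` in `A`. -/
def twoDigitSum (b : ℕ) (A : Finset ℕ) (m : ℕ) (s : ℂ) : ℂ :=
  ∑ a₁ ∈ A.erase 0, ∑ a₂ ∈ A, ((a₁ : ℂ) * (b : ℂ) + (a₂ : ℂ)) ^ (-s - (m : ℂ))

/-- `g` is meromorphic on the whole plane and agrees with `f` on the half-plane `x < Re s`. -/
def IsMeromorphicContinuation (x : ℝ) (f g : ℂ → ℂ) : Prop :=
  MeromorphicOn g Set.univ ∧ ∀ s : ℂ, x < s.re → g s = f s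

end RestrictedDirichlet

end

namespace RestrictedDirichlet

open Filter Topology Complex

variable {b : ℕ} {A : Finset ℕ}

/-! An admissible integer with `l + 2` digits is `b ^ l * (n + x)`, where `n` carries the two
leading digits and `x ∈ [0, 1]` is the value of a word of length `l`. As `n ≥ b ≥ 2`, the binomial
series expands `(n + x) ^ (-s)`; summing over words, then over `l`, gives the expansion of `K` in
the half-plane (`hasSum_K_sub_digitSum`). Splitting off the first letter of a word yields a
triangular recursion for the `u_m` (`αFactor_mul_u`), so `u_m` becomes entire after multiplication
by the factors of `α` with index at most `m`. The functions `α * u_m` obey the same recursion on all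
of `ℂ` (`αFactor_mul_αu`), which forces growth `O((3/2) ^ m)` on discs (`exists_norm_αu_le`). The
two-digit sums decay like `b ^ (-m)`, so the series converges locally uniformly to an entire
function. Dividing by `α` creates only simple poles, because `α` has only simple zeros
(`deriv_α_ne_zero`). -/

/-! ### The product `α` and its zeros -/

lemma norm_base_cpow (hb : 1 < b) (z : ℂ) : ‖(b : ℂ) ^ z‖ = (b : ℝ) ^ z.re :=
  norm_natCast_cpow_of_pos (by omega) z

lemma differentiable_base_cpow (hb : 1 < b) (c : ℂ) :
    Differentiable ℂ (fun s : ℂ => (b : ℂ) ^ (-s - c)) := by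
  have : (b : ℂ) ≠ 0 := by exact_mod_cast (by omega : b ≠ 0)
  exact fun s => ((differentiableAt_id.neg).sub_const c).const_cpow (Or.inl this)

lemma differentiable_αFactor (hb : 1 < b) (n : ℕ) :
    Differentiable ℂ (fun s => αFactor b A s n) := by
  unfold αFactor
  exact (differentiable_const _).sub ((differentiable_base_cpow hb n).mul_const _)

lemma αFactor_add (s : ℂ) (m n : ℕ) : αFactor b A (s + m) n = αFactor b A s (n + m) := by
  unfold αFactor
  push_cast
  ring_nf

/-- The deviation of the `n`-th factor of `α` from `1` decays like `b ^ (-n)`, uniformly on right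
half-planes. -/
lemma norm_αFactor_term_le (hb : 1 < b) {R : ℝ} {s : ℂ} (hs : -R ≤ s.re) (n : ℕ) :
    ‖-((b : ℂ) ^ (-s - (n : ℂ)) * (A.card : ℂ))‖ ≤ (b : ℝ) ^ R * A.card * ((b : ℝ)⁻¹) ^ n := by
  have hb' : (1 : ℝ) < b := by exact_mod_cast hb
  rw [norm_neg, norm_mul, norm_base_cpow hb, norm_natCast]
  have : (b : ℝ) ^ (-s - (n : ℂ)).re ≤ (b : ℝ) ^ R * ((b : ℝ)⁻¹) ^ n := by
    rw [inv_pow, ← Real.rpow_natCast, ← Real.rpow_neg (by positivity),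
      ← Real.rpow_add (by positivity)]
    apply Real.rpow_le_rpow_of_exponent_le hb'.le
    simp
    linarith
  calc _ ≤ ((b : ℝ) ^ R * ((b : ℝ)⁻¹) ^ n) * A.card := by gcongr
    _ = _ := by ring

lemma summable_αFactor_bound (hb : 1 < b) (R : ℝ) :
    Summable (fun n : ℕ => (b : ℝ) ^ R * A.card * ((b : ℝ)⁻¹) ^ n) := by
  have hb' : (1 : ℝ) < b := by exact_mod_cast hb
  exact (summable_geometric_of_lt_one (by positivity) (inv_lt_one_of_one_lt₀ hb')).mul_left _

lemma summable_norm_αFactor_term (hb : 1 < b) (s : ℂ) :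
    Summable (fun n : ℕ => ‖-((b : ℂ) ^ (-s - (n : ℂ)) * (A.card : ℂ))‖) :=
  (summable_αFactor_bound hb (-s.re)).of_nonneg_of_le (fun _ => norm_nonneg _)
    (norm_αFactor_term_le hb (by simp))

lemma αFactor_eq_one_add (s : ℂ) :
    αFactor b A s = fun n : ℕ => 1 + -((b : ℂ) ^ (-s - (n : ℂ)) * (A.card : ℂ)) := by
  funext n
  rw [αFactor, sub_eq_add_neg]

lemma multipliable_αFactor (hb : 1 < b) (s : ℂ) : Multipliable (αFactor b A s) := by
  rw [αFactor_eq_one_add]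
  exact multipliable_one_add_of_summable (summable_norm_αFactor_term hb s)

lemma differentiable_α (hb : 1 < b) : Differentiable ℂ (α b A) := by
  intro s
  -- The bound on the factors is uniform only on right half-planes, so each point gets its own.
  let H : Set ℂ := {z | s.re - 1 < z.re}
  have hH : IsOpen H := isOpen_lt continuous_const continuous_re
  have hprod := (summable_αFactor_bound (A := A) hb (1 - s.re)).hasProdLocallyUniformlyOn_nat_one_add
    (f := fun (n : ℕ) (z : ℂ) => -((b : ℂ) ^ (-z - (n : ℂ)) * (A.card : ℂ))) hH
    (Eventually.of_forall fun n z hz =>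
      norm_αFactor_term_le hb (by simp only [H, Set.mem_ofPred_eq] at hz; linarith) n)
    (fun n => (((differentiable_base_cpow hb n).mul_const _).neg).continuous.continuousOn)
  have hd := hprod.tendstoLocallyUniformlyOn_finsetRange.differentiableOn
    (Eventually.of_forall fun N => ?_) hH
  · refine ((hd.congr fun z _ => ?_).differentiableAt (hH.mem_nhds (by simp [H])))
    simp only [α, αFactor, sub_eq_add_neg]
  · refine DifferentiableOn.fun_finsetProd fun n _ => ?_
    exact ((differentiable_const _).add
      ((differentiable_base_cpow hb n).mul_const _).neg).differentiableOn

lemma α_ne_zero_of_factors (hb : 1 < b) {s : ℂ} (h : ∀ n, αFactor b A s n ≠ 0) :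
    α b A s ≠ 0 := by
  rw [αFactor_eq_one_add] at h
  rw [α, αFactor_eq_one_add]
  exact tprod_one_add_ne_zero_of_summable h (summable_norm_αFactor_term hb s)

/-- The tail of the product from index `m` on is `α` at `s + m`; this peels off its first factor. -/
lemma α_add_natCast (hb : 1 < b) (s : ℂ) (m : ℕ) :
    α b A (s + m) = αFactor b A s m * α b A (s + (m + 1 : ℕ)) := by
  have hshift : ∀ n, αFactor b A (s + m) (n + 1) = αFactor b A (s + (m + 1 : ℕ)) n := by
    intro n
    rw [αFactor_add, αFactor_add, add_assoc, add_comm 1 m]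
  rw [α, tprod_eq_zero_mul' (by simpa only [hshift] using multipliable_αFactor hb _),
    αFactor_add, zero_add, α]
  simp only [hshift]

lemma prod_αFactor_mul_α_add (hb : 1 < b) (s : ℂ) (m : ℕ) :
    (∏ n ∈ Finset.range m, αFactor b A s n) * α b A (s + m) = α b A s := by
  induction m with
  | zero => simp
  | succ m ih => rw [Finset.prod_range_succ, mul_assoc, ← α_add_natCast hb, ih]

lemma prod_Ico_αFactor_mul_α_add (hb : 1 < b) (s : ℂ) {j m : ℕ} (hjm : j ≤ m) :
    (∏ n ∈ Finset.Ico j m, αFactor b A s n) * α b A (s + m) = α b A (s + j) := by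
  induction m, hjm using Nat.le_induction with
  | base => simp
  | succ m hm ih => rw [Finset.prod_Ico_succ_top hm, mul_assoc, ← α_add_natCast hb, ih]

lemma αFactor_ne_zero (hb : 1 < b) {s : ℂ} (hs : α b A s ≠ 0) (n : ℕ) :
    αFactor b A s n ≠ 0 := by
  rw [← prod_αFactor_mul_α_add hb s (n + 1), Finset.prod_range_succ] at hs
  exact right_ne_zero_of_mul (left_ne_zero_of_mul hs)

/-- At most one factor of `α` vanishes at a given point. -/
lemma αFactor_ne_zero_of_ne (hb : 1 < b) {s : ℂ} {n k : ℕ} (hnk : k ≠ n)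
    (h : αFactor b A s n = 0) : αFactor b A s k ≠ 0 := by
  intro h'
  have hb' : (1 : ℝ) < b := by exact_mod_cast hb
  have key : (b : ℂ) ^ (-s - (n : ℂ)) * (A.card : ℂ) = (b : ℂ) ^ (-s - (k : ℂ)) * (A.card : ℂ) := by
    rw [← sub_eq_zero.mp h, ← sub_eq_zero.mp h']
  have hA : (A.card : ℂ) ≠ 0 := by
    intro h0
    simp [αFactor, h0] at h
  -- Norms see only the exponent `-Re s - n`, which determines `n`.
  have h2 := congrArg norm (mul_right_cancel₀ hA key)
  rw [norm_base_cpow hb, norm_base_cpow hb, Real.rpow_right_inj (by positivity) hb'.ne'] at h2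
  simp at h2
  exact hnk h2.symm

lemma exists_αFactor_eq_zero (hb : 1 < b) {s : ℂ} (hs : α b A s = 0) :
    ∃ n, αFactor b A s n = 0 := by
  by_contra! h
  exact α_ne_zero_of_factors hb h hs

/-- At a zero `b ^ (-s - n) * N = 1`, so the derivative collapses to `log b`. -/
lemma deriv_αFactor_ne_zero (hb : 1 < b) {s : ℂ} {n : ℕ} (h : αFactor b A s n = 0) :
    deriv (fun s => αFactor b A s n) s ≠ 0 := by
  have hb0 : (b : ℂ) ≠ 0 := by exact_mod_cast (by omega : b ≠ 0)
  have hd : HasDerivAt (fun s => αFactor b A s n)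
      (-((b : ℂ) ^ (-s - (n : ℂ)) * Complex.log b * (-1) * (A.card : ℂ))) s :=
    ((((hasDerivAt_id s).neg.sub_const (n : ℂ)).const_cpow (Or.inl hb0)).mul_const _).const_sub 1
  rw [hd.deriv]
  have h1 : (b : ℂ) ^ (-s - (n : ℂ)) * (A.card : ℂ) = 1 := (sub_eq_zero.mp h).symm
  have h2 : -((b : ℂ) ^ (-s - (n : ℂ)) * Complex.log b * (-1) * (A.card : ℂ)) = Complex.log b := by
    linear_combination Complex.log b * h1
  rw [h2, Complex.natCast_log.symm]
  exact_mod_cast (Real.log_pos (by exact_mod_cast hb)).ne'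

/-- The zeros of `α` are simple. -/
lemma deriv_α_ne_zero (hb : 1 < b) {s : ℂ} (hs : α b A s = 0) : deriv (α b A) s ≠ 0 := by
  obtain ⟨n, hn⟩ := exists_αFactor_eq_zero hb hs
  -- Isolate the vanishing factor: the product rule then leaves its derivative times nonvanishing
  -- terms.
  have hfun : α b A = fun z => αFactor b A z n *
      ((∏ k ∈ Finset.range n, αFactor b A z k) * α b A (z + (n + 1 : ℕ))) := by
    funext z
    rw [← prod_αFactor_mul_α_add hb z (n + 1), Finset.prod_range_succ]
    ring
  have hd1 := (differentiable_αFactor (A := A) hb n) s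
  have hd2 : DifferentiableAt ℂ (fun z => (∏ k ∈ Finset.range n, αFactor b A z k) *
      α b A (z + (n + 1 : ℕ))) s :=
    (DifferentiableAt.fun_finsetProd fun k _ => differentiable_αFactor hb k s).mul
      ((differentiable_α hb).comp (differentiable_id.add_const _) s)
  rw [hfun, deriv_fun_mul hd1 hd2, hn, zero_mul, add_zero]
  refine mul_ne_zero (deriv_αFactor_ne_zero hb hn) (mul_ne_zero ?_ ?_)
  · exact Finset.prod_ne_zero_iff.mpr fun k hk =>
      αFactor_ne_zero_of_ne hb (Finset.mem_range.mp hk).ne hn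
  · refine α_ne_zero_of_factors hb fun k => ?_
    rw [αFactor_add]
    exact αFactor_ne_zero_of_ne hb (by omega) hn

lemma meromorphicOrderAt_α_le_one (hb : 1 < b) (s : ℂ) : meromorphicOrderAt (α b A) s ≤ 1 := by
  have han : AnalyticAt ℂ (α b A) s := (differentiable_α hb).analyticAt s
  rw [han.meromorphicOrderAt_eq]
  by_cases hs : α b A s = 0
  · rw [han.analyticOrderAt_eq_one_of_zero_deriv_ne_zero hs (deriv_α_ne_zero hb hs)]
    simp
  · rw [han.analyticOrderAt_eq_zero.mpr hs]
    simp

lemma card_lt_rpow (hb : 1 < b) (hA : A.Nonempty) {σ : ℝ} (hs : s₀ b A < σ) :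
    (A.card : ℝ) * (b : ℝ) ^ (-σ) < 1 := by
  have hb' : (1 : ℝ) < b := by exact_mod_cast hb
  have hc : (0 : ℝ) < A.card := by exact_mod_cast hA.card_pos
  rw [s₀, Real.logb_lt_iff_lt_rpow hb' hc] at hs
  rw [Real.rpow_neg (by positivity), ← div_eq_mul_inv, div_lt_one (by positivity)]
  exact hs

lemma α_ne_zero (hb : 1 < b) (hA : A.Nonempty) {s : ℂ} (hs : s₀ b A < s.re) : α b A s ≠ 0 := by
  refine α_ne_zero_of_factors hb fun n h => ?_
  have hb' : (1 : ℝ) < b := by exact_mod_cast hb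
  have h1 := congrArg norm (sub_eq_zero.mp h)
  have h3 : (b : ℝ) ^ (-s - (n : ℂ)).re ≤ (b : ℝ) ^ (-s.re) :=
    Real.rpow_le_rpow_of_exponent_le hb'.le (by simp)
  rw [norm_mul, norm_base_cpow hb, norm_natCast, norm_one] at h1
  have h2 := card_lt_rpow hb hA hs
  nlinarith [A.card.cast_nonneg (α := ℝ)]

/-! ### Words and the recursion for `u_m` -/

/-- The real number `a₁ / b + ⋯ + a_l / b ^ l` attached to a word. -/
noncomputable def wordVal (b : ℕ) {l : ℕ} (a : Fin l → ℕ) : ℝ :=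
  ∑ i : Fin l, (a i : ℝ) / (b : ℝ) ^ ((i : ℕ) + 1)

/-- The sum of the `k`-th powers of the admissible digits. -/
noncomputable def powerSum (A : Finset ℕ) (k : ℕ) : ℂ :=
  ∑ a ∈ A, (a : ℂ) ^ k

/-- Splitting off the first letter drives the recursion for `u_m`; splitting off the last
(`sum_words_snoc`) matches appending a digit to an integer. -/
lemma sum_words_cons {l : ℕ} (f : (Fin (l + 1) → ℕ) → ℂ) :
    ∑ w ∈ Fintype.piFinset (fun _ : Fin (l + 1) => A), f w =
      ∑ a ∈ A, ∑ w ∈ Fintype.piFinset (fun _ : Fin l => A), f (Fin.cons a w) := by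
  rw [← Finset.sum_product']
  refine Finset.sum_nbij' (fun w => (w 0, Fin.tail w)) (fun p => Fin.cons p.1 p.2) ?_ ?_ ?_ ?_ ?_
  · intro w hw
    simp only [Fintype.mem_piFinset] at hw
    simp [Fin.tail, hw]
  · rintro ⟨a, w⟩ h
    simp only [Finset.mem_product, Fintype.mem_piFinset] at h
    simp only [Fintype.mem_piFinset]
    exact fun i => Fin.cases (by simpa using h.1) (by simpa using h.2) i
  · simp
  · simp
  · simp

lemma sum_words_snoc {l : ℕ} (f : (Fin (l + 1) → ℕ) → ℂ) :
    ∑ w ∈ Fintype.piFinset (fun _ : Fin (l + 1) => A), f w =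
      ∑ a ∈ A, ∑ w ∈ Fintype.piFinset (fun _ : Fin l => A),
        f (Fin.snoc (α := fun _ => ℕ) w a) := by
  rw [← Finset.sum_product']
  refine Finset.sum_nbij' (fun w => (w (Fin.last l), Fin.init w))
    (fun p => Fin.snoc (α := fun _ => ℕ) p.2 p.1) ?_ ?_ ?_ ?_ ?_
  · intro w hw
    simp only [Fintype.mem_piFinset] at hw
    simp [Fin.init, hw]
  · rintro ⟨a, w⟩ h
    simp only [Finset.mem_product, Fintype.mem_piFinset] at h
    simp only [Fintype.mem_piFinset]
    exact fun i => Fin.lastCases (by simpa using h.1) (by simpa using h.2) i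
  · simp
  · simp
  · simp

lemma wordVal_cons (b : ℕ) {l : ℕ} (a : ℕ) (w : Fin l → ℕ) :
    wordVal b (Fin.cons a w : Fin (l + 1) → ℕ) = (a + wordVal b w) / b := by
  simp only [wordVal, Fin.sum_univ_succ, Fin.cons_zero, Fin.cons_succ, add_div, Finset.sum_div]
  simp [pow_succ, div_div]

lemma wordVal_snoc (b : ℕ) {l : ℕ} (a : ℕ) (w : Fin l → ℕ) :
    wordVal b (Fin.snoc (α := fun _ => ℕ) w a) = wordVal b w + a / (b : ℝ) ^ (l + 1) := by
  simp [wordVal, Fin.sum_univ_castSucc]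

lemma wordVal_nonneg (b : ℕ) {l : ℕ} (w : Fin l → ℕ) : 0 ≤ wordVal b w :=
  Finset.sum_nonneg fun _ _ => by positivity

lemma wordVal_le_one (hb : 1 < b) (hA : ∀ a ∈ A, a < b) {l : ℕ} {w : Fin l → ℕ}
    (hw : w ∈ Fintype.piFinset (fun _ : Fin l => A)) : wordVal b w ≤ 1 := by
  have hb' : (1 : ℝ) < b := by exact_mod_cast hb
  induction l with
  | zero => simp [wordVal]
  | succ l ih =>
    simp only [Fintype.mem_piFinset] at hw ih
    have h1 := ih (w := Fin.tail w) fun i => hw i.succ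
    have h0 : (w 0 : ℝ) + 1 ≤ b := by exact_mod_cast hA _ (hw 0)
    rw [← Fin.cons_self_tail w, wordVal_cons, div_le_one (by positivity)]
    linarith

lemma uBlock_eq (m l : ℕ) (s : ℂ) :
    uBlock b A m l s = ∑ w ∈ Fintype.piFinset (fun _ : Fin l => A),
      (wordVal b w : ℂ) ^ m * (b : ℂ) ^ (-((l : ℂ) * s)) := by
  simp [uBlock, wordVal]

lemma uBlock_zero (m : ℕ) (s : ℂ) : uBlock b A m 0 s = 0 ^ m := by
  simp [uBlock]

/-- There are `N ^ l` words, all with value in `[0, 1]`. That the bound is independent of `m` later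
justifies exchanging the sums over `l` and `m`. -/
lemma norm_uBlock_le (hb : 1 < b) (hA : ∀ a ∈ A, a < b) (m l : ℕ) (s : ℂ) :
    ‖uBlock b A m l s‖ ≤ (A.card * (b : ℝ) ^ (-s.re)) ^ l := by
  rw [uBlock_eq]
  refine (norm_sum_le_of_le (f := fun w => (wordVal b w : ℂ) ^ m * (b : ℂ) ^ (-((l : ℂ) * s))) _
    (n := fun _ => ((b : ℝ) ^ (-s.re)) ^ l) fun w hw => ?_).trans_eq ?_
  · rw [norm_mul, norm_base_cpow hb, norm_pow, norm_real, Real.norm_of_nonneg (wordVal_nonneg _ _)]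
    have h1 : wordVal b w ^ m ≤ 1 := pow_le_one₀ (wordVal_nonneg _ _) (wordVal_le_one hb hA hw)
    have h2 : (b : ℝ) ^ (-((l : ℂ) * s)).re = ((b : ℝ) ^ (-s.re)) ^ l := by
      rw [← Real.rpow_mul_natCast (by positivity)]
      simp [mul_comm]
    rw [h2]
    exact mul_le_of_le_one_left (by positivity) h1
  · simp [mul_pow]

lemma summable_geometric_card (hb : 1 < b) (hA : A.Nonempty) {σ : ℝ} (hs : s₀ b A < σ) :
    Summable (fun l : ℕ => (A.card * (b : ℝ) ^ (-σ)) ^ l) :=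
  summable_geometric_of_lt_one (by positivity) (card_lt_rpow hb hA hs)

lemma summable_uBlock (hb : 1 < b) (hA : ∀ a ∈ A, a < b) (hA' : A.Nonempty) (m : ℕ) {s : ℂ}
    (hs : s₀ b A < s.re) : Summable (fun l : ℕ => uBlock b A m l s) :=
  (summable_geometric_card hb hA' hs).of_norm_bounded (norm_uBlock_le hb hA m · s)

lemma hasSum_uBlock (hb : 1 < b) (hA : ∀ a ∈ A, a < b) (hA' : A.Nonempty) (m : ℕ) {s : ℂ}
    (hs : s₀ b A < s.re) : HasSum (fun l : ℕ => uBlock b A m l s) (u b A m s) := by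
  have h := summable_uBlock hb hA hA' m hs
  rw [u, ← uBlock_zero (b := b) (A := A) m s, ← h.tsum_eq_zero_add]
  exact h.hasSum

/-- With first letter `a` and remaining value `x` the word has value `(a + x) / b`; expand its
`m`-th power binomially. -/
lemma uBlock_succ (hb : 1 < b) (m l : ℕ) (s : ℂ) :
    uBlock b A m (l + 1) s = (b : ℂ) ^ (-s - (m : ℂ)) *
      ∑ j ∈ Finset.range (m + 1), (m.choose j : ℂ) * powerSum A (m - j) * uBlock b A j l s := by
  have hb0 : (b : ℂ) ≠ 0 := by exact_mod_cast (by omega : b ≠ 0)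
  have hexp : (b : ℂ) ^ (-(((l + 1 : ℕ) : ℂ) * s)) =
      (b : ℂ) ^ (-s - (m : ℂ)) * (b : ℂ) ^ m * (b : ℂ) ^ (-((l : ℂ) * s)) := by
    rw [← cpow_natCast, ← cpow_add _ _ hb0, ← cpow_add _ _ hb0]
    congr 1
    push_cast
    ring
  have hR : (b : ℂ) ^ (-s - (m : ℂ)) * ∑ j ∈ Finset.range (m + 1),
      (m.choose j : ℂ) * powerSum A (m - j) * uBlock b A j l s =
      ∑ j ∈ Finset.range (m + 1), ∑ a ∈ A, ∑ w ∈ Fintype.piFinset (fun _ : Fin l => A),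
        (b : ℂ) ^ (-s - (m : ℂ)) * ((m.choose j : ℂ) *
          ((a : ℂ) ^ (m - j) * ((wordVal b w : ℂ) ^ j * (b : ℂ) ^ (-((l : ℂ) * s))))) := by
    rw [Finset.mul_sum]
    refine Finset.sum_congr rfl fun j _ => ?_
    rw [mul_assoc (m.choose j : ℂ), powerSum, uBlock_eq, Finset.sum_mul_sum, Finset.mul_sum,
      Finset.mul_sum]
    refine Finset.sum_congr rfl fun a _ => ?_
    rw [Finset.mul_sum, Finset.mul_sum]
  rw [hR, uBlock_eq, sum_words_cons]
  conv_rhs => rw [Finset.sum_comm]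
  refine Finset.sum_congr rfl fun a _ => ?_
  conv_rhs => rw [Finset.sum_comm]
  refine Finset.sum_congr rfl fun w _ => ?_
  rw [wordVal_cons, hexp, add_comm (a : ℝ)]
  push_cast
  rw [div_pow, add_pow, Finset.sum_div, Finset.sum_mul]
  refine Finset.sum_congr rfl fun j _ => ?_
  field_simp

/-- The zeroth power sum is `N`, so the term `j = m` is `b ^ (-s - m) * N * u_m`; moving it to the
left creates the factor. -/
lemma αFactor_mul_u (hb : 1 < b) (hA : ∀ a ∈ A, a < b) (hA' : A.Nonempty) (m : ℕ) {s : ℂ}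
    (hs : s₀ b A < s.re) :
    αFactor b A s m * u b A m s = 0 ^ m + (b : ℂ) ^ (-s - (m : ℂ)) *
      ∑ j ∈ Finset.range m, (m.choose j : ℂ) * powerSum A (m - j) * u b A j s := by
  have h1 : HasSum (fun l : ℕ => uBlock b A m (l + 1) s) ((b : ℂ) ^ (-s - (m : ℂ)) *
      ∑ j ∈ Finset.range (m + 1), (m.choose j : ℂ) * powerSum A (m - j) * u b A j s) := by
    simp only [uBlock_succ hb]
    exact (hasSum_sum fun j _ => (hasSum_uBlock hb hA hA' j hs).mul_left _).mul_left _
  have h2 : u b A m s = 0 ^ m + (b : ℂ) ^ (-s - (m : ℂ)) *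
      ∑ j ∈ Finset.range (m + 1), (m.choose j : ℂ) * powerSum A (m - j) * u b A j s := by
    rw [← h1.tsum_eq, u]
  rw [Finset.sum_range_succ] at h2
  simp only [Nat.choose_self, Nat.sub_self, Nat.cast_one, powerSum, pow_zero, Finset.sum_const,
    nsmul_eq_mul, mul_one, one_mul] at h2
  simp only [αFactor, powerSum]
  linear_combination h2

/-! ### Continuation of `u_m` and growth of `α * u_m` -/

/-- The entire function `u_m(s) * ∏_{n ≤ m} (1 - b ^ (-s - n) * N)`. -/
noncomputable def uNumerator (b : ℕ) (A : Finset ℕ) (m : ℕ) (s : ℂ) : ℂ :=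
  -- This is the recursion for `u_m` times the factors of index below `m`; the `Ico` product
  -- supplies those missing from the `j`-th numerator.
  0 ^ m * ∏ n ∈ Finset.range m, αFactor b A s n + (b : ℂ) ^ (-s - (m : ℂ)) *
    ∑ j : Fin m, (m.choose j : ℂ) * powerSum A (m - j) *
      (uNumerator b A j s * ∏ n ∈ Finset.Ico (j + 1 : ℕ) m, αFactor b A s n)
termination_by m
decreasing_by exact j.2

lemma uNumerator_eq (m : ℕ) (s : ℂ) :
    uNumerator b A m s = 0 ^ m * ∏ n ∈ Finset.range m, αFactor b A s n +
      (b : ℂ) ^ (-s - (m : ℂ)) * ∑ j ∈ Finset.range m, (m.choose j : ℂ) * powerSum A (m - j) *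
        (uNumerator b A j s * ∏ n ∈ Finset.Ico (j + 1) m, αFactor b A s n) := by
  rw [uNumerator, Finset.sum_range]

lemma differentiable_prod_αFactor (hb : 1 < b) (t : Finset ℕ) :
    Differentiable ℂ fun s => ∏ n ∈ t, αFactor b A s n :=
  fun s => DifferentiableAt.fun_finsetProd fun n _ => differentiable_αFactor hb n s

lemma differentiable_uNumerator (hb : 1 < b) (m : ℕ) : Differentiable ℂ (uNumerator b A m) := by
  induction m using Nat.strong_induction_on with
  | _ m ih =>
    have hprod := differentiable_prod_αFactor (A := A) hb
    rw [funext (uNumerator_eq (b := b) (A := A) m)]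
    refine ((hprod _).const_mul _).add ((differentiable_base_cpow hb m).mul ?_)
    refine Differentiable.fun_sum fun j hj => ?_
    exact ((ih j (Finset.mem_range.mp hj)).mul (hprod _)).const_mul _

lemma uNumerator_eq_u_mul (hb : 1 < b) (hA : ∀ a ∈ A, a < b) (hA' : A.Nonempty) (m : ℕ) {s : ℂ}
    (hs : s₀ b A < s.re) :
    uNumerator b A m s = u b A m s * ∏ n ∈ Finset.range (m + 1), αFactor b A s n := by
  induction m using Nat.strong_induction_on with
  | _ m ih =>
    have hsum : ∑ j ∈ Finset.range m, (m.choose j : ℂ) * powerSum A (m - j) *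
        (uNumerator b A j s * ∏ n ∈ Finset.Ico (j + 1) m, αFactor b A s n) =
        (∑ j ∈ Finset.range m, (m.choose j : ℂ) * powerSum A (m - j) * u b A j s) *
          ∏ n ∈ Finset.range m, αFactor b A s n := by
      rw [Finset.sum_mul]
      refine Finset.sum_congr rfl fun j hj => ?_
      have hj := Finset.mem_range.mp hj
      rw [ih j hj, mul_assoc (u b A j s), Finset.prod_range_mul_prod_Ico _ (Nat.succ_le_of_lt hj)]
      ring
    rw [uNumerator_eq, hsum, Finset.prod_range_succ]
    linear_combination -(∏ n ∈ Finset.range m, αFactor b A s n) * αFactor_mul_u hb hA hA' m hs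

/-- The meromorphic continuation of `u_m`. -/
noncomputable def uCont (b : ℕ) (A : Finset ℕ) (m : ℕ) (s : ℂ) : ℂ :=
  uNumerator b A m s / ∏ n ∈ Finset.range (m + 1), αFactor b A s n

/-- The entire continuation of `α * u_m`. -/
noncomputable def αu (b : ℕ) (A : Finset ℕ) (m : ℕ) (s : ℂ) : ℂ :=
  uNumerator b A m s * α b A (s + (m + 1 : ℕ))

lemma differentiable_αu (hb : 1 < b) (m : ℕ) : Differentiable ℂ (αu b A m) :=
  (differentiable_uNumerator hb m).mul
    ((differentiable_α hb).comp (differentiable_id.add_const _))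

lemma meromorphicOn_uCont (hb : 1 < b) (m : ℕ) : MeromorphicOn (uCont b A m) Set.univ :=
  fun s _ => ((differentiable_uNumerator hb m).analyticAt s).meromorphicAt.div
    ((differentiable_prod_αFactor hb _).analyticAt s).meromorphicAt

lemma prod_αFactor_ne_zero (hb : 1 < b) {s : ℂ} (hs : α b A s ≠ 0) (t : Finset ℕ) :
    ∏ n ∈ t, αFactor b A s n ≠ 0 :=
  Finset.prod_ne_zero_iff.mpr fun n _ => αFactor_ne_zero hb hs n

lemma analyticAt_uCont (hb : 1 < b) (m : ℕ) {s : ℂ} (hs : α b A s ≠ 0) :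
    AnalyticAt ℂ (uCont b A m) s :=
  ((differentiable_uNumerator hb m).analyticAt s).div
    ((differentiable_prod_αFactor hb _).analyticAt s) (prod_αFactor_ne_zero hb hs _)

lemma αu_eq_mul_uCont (hb : 1 < b) (m : ℕ) {s : ℂ} (hs : α b A s ≠ 0) :
    αu b A m s = α b A s * uCont b A m s := by
  have := prod_αFactor_ne_zero hb hs (Finset.range (m + 1))
  rw [αu, uCont, ← prod_αFactor_mul_α_add hb s (m + 1)]
  field_simp

lemma uCont_eq_u (hb : 1 < b) (hA : ∀ a ∈ A, a < b) (hA' : A.Nonempty) (m : ℕ) {s : ℂ}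
    (hs : s₀ b A < s.re) : uCont b A m s = u b A m s := by
  rw [uCont, uNumerator_eq_u_mul hb hA hA' m hs,
    mul_div_cancel_right₀ _ (prod_αFactor_ne_zero hb (α_ne_zero hb hA' hs) _)]

/-- The numerators satisfy the recursion by definition, and tails of `α` complete each partial
product, so no restriction on `s` is needed. -/
lemma αFactor_mul_αu (hb : 1 < b) (m : ℕ) (s : ℂ) :
    αFactor b A s m * αu b A m s = 0 ^ m * α b A s + (b : ℂ) ^ (-s - (m : ℂ)) *
      ∑ j ∈ Finset.range m, (m.choose j : ℂ) * powerSum A (m - j) * αu b A j s := by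
  have h1 : αFactor b A s m * αu b A m s = uNumerator b A m s * α b A (s + m) := by
    rw [αu, α_add_natCast hb s m]
    ring
  rw [h1, uNumerator_eq, add_mul, mul_assoc, prod_αFactor_mul_α_add hb, mul_assoc, Finset.sum_mul]
  congr 2
  refine Finset.sum_congr rfl fun j hj => ?_
  rw [αu, ← prod_Ico_αFactor_mul_α_add hb s (Nat.succ_le_of_lt (Finset.mem_range.mp hj))]
  ring

lemma norm_powerSum_le (hA : ∀ a ∈ A, a < b) (k : ℕ) :
    ‖powerSum A k‖ ≤ A.card * ((b : ℝ) - 1) ^ k := by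
  refine (norm_sum_le_of_le _ (n := fun _ => ((b : ℝ) - 1) ^ k) fun a ha => ?_).trans_eq (by simp)
  rw [norm_pow, norm_natCast]
  have : (a : ℝ) + 1 ≤ b := by exact_mod_cast hA a ha
  exact pow_le_pow_left₀ (by positivity) (by linarith) k

/-- On every disc the functions `α * u_m` grow more slowly than `b ^ m`. -/
lemma exists_norm_αu_le (hb : 1 < b) (hA : ∀ a ∈ A, a < b) (R : ℝ) :
    ∃ C : ℝ, 0 ≤ C ∧ ∀ (m : ℕ), ∀ s ∈ Metric.closedBall (0 : ℂ) R,
      ‖αu b A m s‖ ≤ C * (3 / 2 : ℝ) ^ m := by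
  have hb' : (2 : ℝ) ≤ b := by exact_mod_cast hb
  have hbound : ∀ m, ∃ c : ℝ, ∀ s ∈ Metric.closedBall (0 : ℂ) R, ‖αu b A m s‖ ≤ c :=
    fun m => (isCompact_closedBall _ _).exists_bound_of_continuousOn
      (differentiable_αu hb m).continuous.continuousOn
  choose c hc using hbound
  set B : ℝ := (b : ℝ) ^ R * A.card with hB
  have hB0 : 0 ≤ B := by positivity
  have hq : ∀ q : ℝ, 0 ≤ q → q < 1 → ∀ᶠ m : ℕ in atTop, B * q ^ m < 1 / 2 := fun q h0 h1 => by
    have := (tendsto_pow_atTop_nhds_zero_of_lt_one h0 h1).const_mul B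
    rw [mul_zero] at this
    exact this.eventually_lt_const (by norm_num)
  -- The ratio `1 / b` keeps the `m`-th factor of `α` at least `1/2` in norm; the ratio `(b + 1/2) /
  -- (3b/2) < 1` makes the induction step contract.
  obtain ⟨M, hM⟩ := eventually_atTop.mp ((hq ((b : ℝ)⁻¹) (by positivity)
    (inv_lt_one_of_one_lt₀ (by linarith))).and (hq ((b + 1 / 2) / (b * (3 / 2))) (by positivity)
    (by rw [div_lt_one (by positivity)]; linarith)))
  refine ⟨∑ j ∈ Finset.range (M + 1), |c j|, Finset.sum_nonneg fun _ _ => abs_nonneg _,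
    fun m s hs => ?_⟩
  set C := ∑ j ∈ Finset.range (M + 1), |c j| with hC
  have hC0 : 0 ≤ C := Finset.sum_nonneg fun _ _ => abs_nonneg _
  have hre : -R ≤ s.re := by
    have := (abs_re_le_norm s).trans (mem_closedBall_zero_iff.mp hs)
    linarith [(abs_le.mp this).1]
  induction m using Nat.strong_induction_on with
  | _ m ih =>
    rcases lt_or_ge m (M + 1) with hm | hm
    · have h1 : |c m| ≤ C :=
        Finset.single_le_sum (f := fun j => |c j|) (fun _ _ => abs_nonneg _) (Finset.mem_range.mpr hm)
      have h2 : (1 : ℝ) ≤ (3 / 2) ^ m := one_le_pow₀ (by norm_num)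
      calc _ ≤ c m := hc m s hs
        _ ≤ C * 1 := by rw [mul_one]; exact (le_abs_self _).trans h1
        _ ≤ _ := by gcongr
    · obtain ⟨hM1, hM2⟩ := hM m (by omega)
      have hterm := norm_αFactor_term_le (A := A) hb hre m
      have hF : 1 / 2 ≤ ‖αFactor b A s m‖ := by
        have := norm_sub_norm_le (1 : ℂ) ((b : ℂ) ^ (-s - (m : ℂ)) * A.card)
        rw [norm_neg] at hterm
        rw [norm_one] at this
        rw [αFactor]
        linarith
      -- Binomial theorem with `3/2 + (b - 1) = b + 1/2`.
      have hsum : ‖∑ j ∈ Finset.range m, (m.choose j : ℂ) * powerSum A (m - j) * αu b A j s‖ ≤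
          A.card * C * (b + 1 / 2) ^ m := by
        calc _ ≤ ∑ j ∈ Finset.range m, A.card * C *
              ((3 / 2 : ℝ) ^ j * ((b : ℝ) - 1) ^ (m - j) * m.choose j) := by
              refine norm_sum_le_of_le _ fun j hj => ?_
              have h1 := ih j (Finset.mem_range.mp hj)
              have h2 := norm_powerSum_le hA (m - j)
              rw [norm_mul, norm_mul, norm_natCast]
              calc _ ≤ (m.choose j : ℝ) * (A.card * ((b : ℝ) - 1) ^ (m - j)) *
                    (C * (3 / 2 : ℝ) ^ j) := by
                    have : (0 : ℝ) ≤ (b : ℝ) - 1 := by linarith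
                    gcongr
                _ = _ := by ring
          _ ≤ ∑ j ∈ Finset.range (m + 1), A.card * C *
              ((3 / 2 : ℝ) ^ j * ((b : ℝ) - 1) ^ (m - j) * m.choose j) := by
              refine Finset.sum_le_sum_of_subset_of_nonneg (by simp) fun j _ _ => ?_
              have : (0 : ℝ) ≤ (b : ℝ) - 1 := by linarith
              positivity
          _ = _ := by
              rw [← Finset.mul_sum, ← add_pow]
              ring_nf
      have hrec := congrArg norm (αFactor_mul_αu (A := A) hb m s)
      rw [zero_pow (by omega), zero_mul, zero_add, norm_mul, norm_mul] at hrec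
      have hpow : ‖(b : ℂ) ^ (-s - (m : ℂ))‖ ≤ (b : ℝ) ^ R * ((b : ℝ)⁻¹) ^ m := by
        rw [norm_base_cpow hb, inv_pow, ← Real.rpow_natCast, ← Real.rpow_neg (by positivity),
          ← Real.rpow_add (by positivity)]
        apply Real.rpow_le_rpow_of_exponent_le (by linarith)
        simp
        linarith
      have h3 : 1 / 2 * ‖αu b A m s‖ ≤ 1 / 2 * (C * (3 / 2) ^ m) := by
        calc _ ≤ ‖αFactor b A s m‖ * ‖αu b A m s‖ := by gcongr
          _ ≤ ((b : ℝ) ^ R * ((b : ℝ)⁻¹) ^ m) * (A.card * C * (b + 1 / 2) ^ m) := by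
              rw [hrec]; gcongr
          _ = (B * ((b + 1 / 2) / (b * (3 / 2))) ^ m) * (C * (3 / 2) ^ m) := by
              rw [div_pow, mul_pow, inv_pow, hB]
              field_simp
          _ ≤ _ := by gcongr
      linarith

/-! ### Binomial series and the entire sum -/

lemma choose_neg_eq {F : Type*} [Field F] [CharZero F] (a : F) (m : ℕ) :
    Ring.choose (-a) m = (-1) ^ m * ((ascPochhammer F m).eval a / (m.factorial : F)) := by
  have h := Ring.factorial_nsmul_multichoose_eq_ascPochhammer a m
  rw [Polynomial.ascPochhammer_smeval_eq_eval, nsmul_eq_mul] at h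
  have hm : (m.factorial : F) ≠ 0 := by exact_mod_cast m.factorial_ne_zero
  rw [Ring.choose_neg', ← h, mul_div_cancel_left₀ _ hm]
  simp [Units.smul_def]

lemma norm_ascPochhammer_eval_le (m : ℕ) {s : ℂ} {R : ℝ} (hs : ‖s‖ ≤ R) :
    ‖(ascPochhammer ℂ m).eval s‖ ≤ (ascPochhammer ℝ m).eval R := by
  have hR : 0 ≤ R := (norm_nonneg s).trans hs
  induction m with
  | zero => simp
  | succ m ih =>
    rw [ascPochhammer_succ_eval, ascPochhammer_succ_eval, norm_mul]
    refine mul_le_mul ih ?_ (norm_nonneg _) ((norm_nonneg _).trans ih)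
    refine (norm_add_le _ _).trans ?_
    simpa using hs

/-- These are the norms of the terms of the binomial series of `(1 + x) ^ (-R)`, of radius at least
`1`. -/
lemma summable_ascPochhammer_mul_pow (R : ℝ) {x : ℝ} (hx0 : 0 ≤ x) (hx : x < 1) :
    Summable fun m : ℕ => |(ascPochhammer ℝ m).eval R / (m.factorial : ℝ)| * x ^ m := by
  have hmem : x ∈ Metric.eball (0 : ℝ) (binomialSeries ℝ (-R)).radius := by
    refine Metric.eball_subset_eball binomialSeries_radius_ge_one ?_
    simpa [Real.enorm_eq_ofReal hx0] using hx
  have := (binomialSeries ℝ (-R)).summable_norm_apply hmem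
  refine this.congr fun m => ?_
  rw [binomialSeries_apply, choose_neg_eq]
  simp [abs_div, abs_of_nonneg hx0]

lemma hasSum_one_add_cpow (s : ℂ) {z : ℂ} (hz : ‖z‖ < 1) :
    HasSum (fun m : ℕ => (-1 : ℂ) ^ m * ((ascPochhammer ℂ m).eval s / (m.factorial : ℂ)) * z ^ m)
      ((1 + z) ^ (-s)) := by
  have hmem : z ∈ Metric.eball (0 : ℂ) 1 := by
    simpa [← ofReal_norm] using hz
  have := one_add_cpow_hasFPowerSeriesOnBall_zero (a := -s) |>.hasSum hmem
  simp only [zero_add] at this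
  refine this.congr_fun fun m => ?_
  rw [binomialSeries_apply, choose_neg_eq]
  simp

/-- Each base lies between `b` and `b ^ 2`: the lower bound gives the decay in `m`, the upper one
controls the power `-s`. -/
lemma norm_twoDigitSum_le (hb : 1 < b) (hA : ∀ a ∈ A, a < b) (m : ℕ) {s : ℂ} {R : ℝ}
    (hs : ‖s‖ ≤ R) :
    ‖twoDigitSum b A m s‖ ≤ (A.erase 0).card * (A.card * ((b : ℝ) ^ 2) ^ R) * ((b : ℝ)⁻¹) ^ m := by
  have hb' : (1 : ℝ) < b := by exact_mod_cast hb
  have hR : 0 ≤ R := (norm_nonneg s).trans hs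
  refine (norm_sum_le_of_le _ (n := fun _ => A.card * (((b : ℝ) ^ 2) ^ R * ((b : ℝ)⁻¹) ^ m))
    fun a₁ h₁ => ?_).trans_eq (by simp; ring)
  refine (norm_sum_le_of_le _ (n := fun _ => ((b : ℝ) ^ 2) ^ R * ((b : ℝ)⁻¹) ^ m)
    fun a₂ h₂ => ?_).trans_eq (by simp)
  have h1 : 1 ≤ a₁ := Nat.one_le_iff_ne_zero.mpr (Finset.ne_of_mem_erase h₁)
  have h1' := hA _ (Finset.mem_of_mem_erase h₁)
  have h2' := hA _ h₂
  have hge : b ≤ a₁ * b + a₂ := by nlinarith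
  have hle : a₁ * b + a₂ ≤ b ^ 2 := by nlinarith
  have hge' : (b : ℝ) ≤ (a₁ * b + a₂ : ℕ) := by exact_mod_cast hge
  have hle' : ((a₁ * b + a₂ : ℕ) : ℝ) ≤ (b : ℝ) ^ 2 := by exact_mod_cast hle
  have hpos : (0 : ℝ) < (a₁ * b + a₂ : ℕ) := by linarith
  have hre : -s.re ≤ R := (neg_le_abs _).trans ((abs_re_le_norm s).trans hs)
  have hc : (a₁ : ℂ) * b + a₂ = ((a₁ * b + a₂ : ℕ) : ℂ) := by push_cast; ring
  rw [hc, norm_natCast_cpow_of_pos (by omega)]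
  have he : (-s - (m : ℂ)).re = -s.re - m := by simp
  rw [he, Real.rpow_sub hpos, Real.rpow_natCast, div_eq_mul_inv, ← inv_pow]
  gcongr
  calc _ ≤ ((a₁ * b + a₂ : ℕ) : ℝ) ^ R :=
        Real.rpow_le_rpow_of_exponent_le (by linarith) hre
    _ ≤ _ := by gcongr

/-- A bound on a disc for the coefficient of `u_m` in the expansion of `K`. -/
lemma norm_coeff_mul_twoDigitSum_le (hb : 1 < b) (hA : ∀ a ∈ A, a < b) (m : ℕ) {s : ℂ} {R : ℝ}
    (hs : ‖s‖ ≤ R) :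
    ‖(-1 : ℂ) ^ m * ((ascPochhammer ℂ m).eval s / (m.factorial : ℂ)) * twoDigitSum b A m s‖ ≤
      (A.erase 0).card * (A.card * ((b : ℝ) ^ 2) ^ R) *
        (|(ascPochhammer ℝ m).eval R / (m.factorial : ℝ)| * ((b : ℝ)⁻¹) ^ m) := by
  have h1 := norm_ascPochhammer_eval_le m hs
  have h2 := norm_twoDigitSum_le hb hA m hs
  rw [norm_mul, norm_mul, norm_pow, norm_neg, norm_one, one_pow, one_mul, norm_div, norm_natCast,
    abs_div, Nat.abs_cast]
  calc _ ≤ |(ascPochhammer ℝ m).eval R| / (m.factorial : ℝ) * ((A.erase 0).card *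
        (A.card * ((b : ℝ) ^ 2) ^ R) * ((b : ℝ)⁻¹) ^ m) := by
        gcongr
        exact h1.trans (le_abs_self _)
    _ = _ := by ring

/-- The terms of the series continuing `α * (K - digitSum)`. -/
noncomputable def contTerm (b : ℕ) (A : Finset ℕ) (m : ℕ) (s : ℂ) : ℂ :=
  (-1 : ℂ) ^ m * ((ascPochhammer ℂ m).eval s / (m.factorial : ℂ)) * αu b A m s *
    twoDigitSum b A m s

lemma exists_summable_bound_contTerm (hb : 1 < b) (hA : ∀ a ∈ A, a < b) (R : ℝ) :
    ∃ B : ℕ → ℝ, Summable B ∧ ∀ m, ∀ s ∈ Metric.closedBall (0 : ℂ) R, ‖contTerm b A m s‖ ≤ B m := by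
  have hb' : (2 : ℝ) ≤ b := by exact_mod_cast hb
  obtain ⟨C, hC, hbound⟩ := exists_norm_αu_le hb hA R
  -- The growth rate `3/2` was chosen below the least possible `b = 2`.
  have hx : 3 / 2 * (b : ℝ)⁻¹ < 1 := by
    rw [← div_eq_mul_inv, div_lt_one (by positivity)]
    linarith
  refine ⟨_, (summable_ascPochhammer_mul_pow R (by positivity) hx).mul_left
    ((A.erase 0).card * (A.card * ((b : ℝ) ^ 2) ^ R) * C), fun m s hs => ?_⟩
  have h1 := norm_coeff_mul_twoDigitSum_le hb hA m (mem_closedBall_zero_iff.mp hs)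
  rw [contTerm, mul_right_comm, norm_mul]
  calc _ ≤ _ := mul_le_mul h1 (hbound m s hs) (norm_nonneg _) (by positivity)
    _ = _ := by rw [mul_pow]; ring

lemma summable_contTerm (hb : 1 < b) (hA : ∀ a ∈ A, a < b) (s : ℂ) :
    Summable fun m => contTerm b A m s := by
  obtain ⟨B, hB, h⟩ := exists_summable_bound_contTerm hb hA ‖s‖
  exact hB.of_norm_bounded fun m => h m s (by simp)

lemma differentiable_twoDigitSum (hb : 1 < b) (m : ℕ) : Differentiable ℂ (twoDigitSum b A m) := by
  intro s
  refine DifferentiableAt.fun_sum fun a₁ h₁ => DifferentiableAt.fun_sum fun a₂ _ => ?_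
  refine ((differentiableAt_id.neg).sub_const _).const_cpow (Or.inl ?_)
  have : 0 < a₁ := Nat.pos_of_ne_zero (Finset.ne_of_mem_erase h₁)
  have : a₁ * b + a₂ ≠ 0 := by positivity
  exact_mod_cast this

lemma differentiable_contTerm (hb : 1 < b) (m : ℕ) : Differentiable ℂ (contTerm b A m) := by
  refine Differentiable.mul (Differentiable.mul ?_ (differentiable_αu hb m))
    (differentiable_twoDigitSum hb m)
  exact ((Polynomial.differentiable _).div_const _).const_mul _

lemma differentiable_tsum_contTerm (hb : 1 < b) (hA : ∀ a ∈ A, a < b) :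
    Differentiable ℂ fun s => ∑' m, contTerm b A m s := by
  intro s
  obtain ⟨B, hB, h⟩ := exists_summable_bound_contTerm hb hA (‖s‖ + 1)
  refine (differentiableOn_tsum_of_summable_norm (U := Metric.ball 0 (‖s‖ + 1)) hB
    (fun m => (differentiable_contTerm hb m).differentiableOn) Metric.isOpen_ball
    fun m z hz => h m z (Metric.ball_subset_closedBall hz)).differentiableAt
      (Metric.isOpen_ball.mem_nhds (by simp))

/-! ### Admissible integers grouped by number of digits -/

/-- The sum of `f n` over the admissible `n` having exactly `k + 1` digits. -/
noncomputable def digitBlock (b : ℕ) (A : Finset ℕ) (k : ℕ) (f : ℂ → ℂ) : ℂ :=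
  ∑ n ∈ Finset.Ico (b ^ k) (b ^ (k + 1)), coeff b A n * f n

lemma coeff_of_lt {a : ℕ} (ha0 : a ≠ 0) (ha : a < b) :
    coeff b A a = if a ∈ A then 1 else 0 := by
  simp [coeff, Admissible, Nat.digits_of_lt b a ha0 ha]

lemma coeff_mul_add (hb : 1 < b) {n a : ℕ} (hn : n ≠ 0) (ha : a < b) :
    coeff b A (b * n + a) = if a ∈ A then coeff b A n else 0 := by
  have h : Admissible b A (b * n + a) ↔ a ∈ A ∧ Admissible b A n := by
    rw [Admissible, add_comm, Nat.digits_add b hb a n ha (Or.inr hn), List.forall_mem_cons,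
      Admissible]
  by_cases h₁ : a ∈ A <;> by_cases h₂ : Admissible b A n <;> simp [coeff, h, h₁, h₂]

lemma sum_Ico_pow_succ (hb : 1 < b) (k : ℕ) (g : ℕ → ℂ) :
    ∑ n ∈ Finset.Ico (b ^ (k + 1)) (b ^ (k + 2)), g n =
      ∑ n ∈ Finset.Ico (b ^ k) (b ^ (k + 1)), ∑ a ∈ Finset.range b, g (b * n + a) := by
  have hb0 : 0 < b := by omega
  rw [← Finset.sum_product']
  refine Finset.sum_nbij' (fun n => (n / b, n % b)) (fun p => b * p.1 + p.2) ?_ ?_ ?_ ?_ ?_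
  · intro n hn
    simp only [Finset.mem_Ico, Finset.mem_product, Finset.mem_range] at hn ⊢
    refine ⟨⟨?_, ?_⟩, Nat.mod_lt _ hb0⟩
    · rw [Nat.le_div_iff_mul_le hb0, ← pow_succ]
      exact hn.1
    · rw [Nat.div_lt_iff_lt_mul hb0, ← pow_succ]
      exact hn.2
  · rintro ⟨n, a⟩ h
    simp only [Finset.mem_Ico, Finset.mem_product, Finset.mem_range] at h ⊢
    obtain ⟨⟨h1, h2⟩, h3⟩ := h
    rw [pow_succ b (k + 1)]
    constructor
    · rw [pow_succ]
      nlinarith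
    · nlinarith
  · intro n _
    exact Nat.div_add_mod n b
  · rintro ⟨n, a⟩ h
    simp only [Finset.mem_product, Finset.mem_range] at h
    simp [Nat.mul_add_div hb0, Nat.div_eq_of_lt h.2, Nat.mod_eq_of_lt h.2]
  · intro n _
    simp [Nat.div_add_mod]

lemma digitBlock_zero (hA : ∀ a ∈ A, a < b) (f : ℂ → ℂ) :
    digitBlock b A 0 f = ∑ a ∈ A.erase 0, f a := by
  have h : ∑ n ∈ Finset.Ico 1 b, coeff b A n * f n =
      ∑ n ∈ Finset.Ico 1 b, if n ∈ A then f n else 0 := by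
    refine Finset.sum_congr rfl fun n hn => ?_
    rw [Finset.mem_Ico] at hn
    rw [coeff_of_lt (by omega) hn.2]
    split_ifs <;> simp
  rw [digitBlock, pow_zero, zero_add, pow_one, h, ← Finset.sum_filter]
  refine Finset.sum_congr ?_ fun _ _ => rfl
  ext a
  simp only [Finset.mem_filter, Finset.mem_Ico, Finset.mem_erase]
  constructor
  · rintro ⟨⟨h1, _⟩, h2⟩
    exact ⟨by omega, h2⟩
  · rintro ⟨h1, h2⟩
    exact ⟨⟨by omega, hA a h2⟩, h2⟩

/-- Removing the last digit is bijective onto pairs. Absorbing that digit into `f` is why blocks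
carry an arbitrary function. -/
lemma digitBlock_succ (hb : 1 < b) (hA : ∀ a ∈ A, a < b) (k : ℕ) (f : ℂ → ℂ) :
    digitBlock b A (k + 1) f = ∑ a ∈ A, digitBlock b A k fun z => f (b * z + a) := by
  simp only [digitBlock]
  rw [sum_Ico_pow_succ hb, Finset.sum_comm (s := A)]
  refine Finset.sum_congr rfl fun n hn => ?_
  have hn0 : n ≠ 0 := by
    have : 0 < b ^ k := by positivity
    have := (Finset.mem_Ico.mp hn).1
    omega
  have hfilter : (Finset.range b).filter (· ∈ A) = A := by
    ext a
    simpa using hA a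
  rw [← hfilter, Finset.sum_filter, hfilter]
  refine Finset.sum_congr rfl fun a ha => ?_
  rw [coeff_mul_add hb hn0 (Finset.mem_range.mp ha)]
  split_ifs <;> simp

/-- The admissible integers with `l + 2` digits are obtained from the pairs of leading digits by
appending words of length `l`. -/
lemma digitBlock_succ_eq_sum_words (hb : 1 < b) (hA : ∀ a ∈ A, a < b) (l : ℕ) (f : ℂ → ℂ) :
    digitBlock b A (l + 1) f = ∑ a₁ ∈ A.erase 0, ∑ a₂ ∈ A,
      ∑ w ∈ Fintype.piFinset (fun _ : Fin l => A),
        f ((b : ℂ) ^ l * (((a₁ : ℂ) * b + a₂) + wordVal b w)) := by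
  have hb0 : (b : ℂ) ≠ 0 := by exact_mod_cast (by omega : b ≠ 0)
  induction l generalizing f with
  | zero =>
    rw [digitBlock_succ hb hA]
    simp only [digitBlock_zero hA]
    rw [Finset.sum_comm]
    simp [wordVal, mul_comm]
  | succ l ih =>
    rw [digitBlock_succ hb hA]
    -- The new last digit enters as `b * (b ^ l * y) + a = b ^ (l + 1) * (y + a / b ^ (l + 1))`.
    simp only [ih, sum_words_snoc, wordVal_snoc]
    rw [Finset.sum_comm]
    refine Finset.sum_congr rfl fun a₁ _ => ?_
    rw [Finset.sum_comm]
    refine Finset.sum_congr rfl fun a₂ _ => Finset.sum_congr rfl fun a _ =>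
      Finset.sum_congr rfl fun w _ => congrArg f ?_
    push_cast
    field_simp
    ring

lemma digitBlock_one (hb : 1 < b) (hA : ∀ a ∈ A, a < b) (k : ℕ) :
    digitBlock b A k (fun _ => 1) = (A.erase 0).card * (A.card : ℂ) ^ k := by
  induction k with
  | zero => simp [digitBlock_zero hA]
  | succ k ih =>
    rw [digitBlock_succ hb hA]
    simp only [ih, Finset.sum_const, nsmul_eq_mul]
    ring

lemma sum_norm_coeff (hb : 1 < b) (hA : ∀ a ∈ A, a < b) (k : ℕ) :
    ∑ n ∈ Finset.Ico (b ^ k) (b ^ (k + 1)), ‖coeff b A n‖ =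
      (A.erase 0).card * (A.card : ℝ) ^ k := by
  have h : ∀ n, ((‖coeff b A n‖ : ℝ) : ℂ) = coeff b A n := fun n => by
    unfold coeff
    split_ifs <;> simp
  have := digitBlock_one hb hA k
  simp only [digitBlock, mul_one] at this
  apply ofReal_injective
  push_cast
  simp only [h, this]

lemma sum_range_pow {M : Type*} [AddCommMonoid M] (hb : 1 < b) (f : ℕ → M) (k : ℕ) :
    ∑ n ∈ Finset.range (b ^ k), f n =
      f 0 + ∑ j ∈ Finset.range k, ∑ n ∈ Finset.Ico (b ^ j) (b ^ (j + 1)), f n := by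
  induction k with
  | zero => simp
  | succ k ih =>
    rw [Finset.sum_range_succ, ← add_assoc, ← ih,
      Finset.sum_range_add_sum_Ico _ (Nat.pow_le_pow_right (by omega) (by omega))]

lemma s₀_nonneg (hb : 1 < b) (hA : A.Nonempty) : 0 ≤ s₀ b A :=
  Real.logb_nonneg (by exact_mod_cast hb) (by exact_mod_cast hA.card_pos)

/-- The block of `k + 1` digits has `#A₁ * N ^ k` members, all at least `b ^ k`, so block sums are
dominated by a geometric series of ratio `N * b ^ (-Re s) < 1`. -/
lemma lseriesSummable_coeff (hb : 1 < b) (hA : ∀ a ∈ A, a < b) (hA' : A.Nonempty) {s : ℂ}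
    (hs : s₀ b A < s.re) : LSeriesSummable (coeff b A) s := by
  have hb' : (1 : ℝ) < b := by exact_mod_cast hb
  have hσ : 0 < s.re := (s₀_nonneg hb hA').trans_lt hs
  have hgeo := (summable_geometric_card hb hA' hs).mul_left ((A.erase 0).card : ℝ)
  refine Summable.of_norm (summable_of_sum_range_le (fun _ => norm_nonneg _) (c := ∑' k : ℕ,
    ((A.erase 0).card : ℝ) * (A.card * (b : ℝ) ^ (-s.re)) ^ k) fun M => ?_)
  calc _ ≤ ∑ n ∈ Finset.range (b ^ M), ‖LSeries.term (coeff b A) s n‖ :=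
        Finset.sum_le_sum_of_subset_of_nonneg
          (Finset.range_subset_range.mpr (Nat.lt_pow_self hb).le) fun _ _ _ => norm_nonneg _
    _ ≤ ∑ k ∈ Finset.range M, ((A.erase 0).card : ℝ) * (A.card * (b : ℝ) ^ (-s.re)) ^ k := by
        rw [sum_range_pow hb, LSeries.term_zero, norm_zero, zero_add]
        refine Finset.sum_le_sum fun k _ => ?_
        calc _ ≤ ∑ n ∈ Finset.Ico (b ^ k) (b ^ (k + 1)),
              ‖coeff b A n‖ * ((b : ℝ) ^ (-s.re)) ^ k := by
              refine Finset.sum_le_sum fun n hn => ?_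
              have hk : 0 < b ^ k := by positivity
              have hn' := (Finset.mem_Ico.mp hn).1
              rw [LSeries.norm_term_eq, if_neg (by omega), div_eq_mul_inv,
                ← Real.rpow_neg (by positivity)]
              refine mul_le_mul_of_nonneg_left ?_ (norm_nonneg _)
              rw [← Real.rpow_mul_natCast (by positivity), mul_comm,
                Real.rpow_natCast_mul (by positivity)]
              exact Real.rpow_le_rpow_of_nonpos (by positivity) (by exact_mod_cast hn')
                (by linarith)
          _ = _ := by
              rw [← Finset.sum_mul, sum_norm_coeff hb hA, mul_pow]
              ring
    _ ≤ _ := hgeo.sum_le_tsum _ fun _ _ => by positivity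

lemma sum_range_pow_term (hb : 1 < b) (s : ℂ) (k : ℕ) :
    ∑ n ∈ Finset.range (b ^ k), LSeries.term (coeff b A) s n =
      ∑ j ∈ Finset.range k, digitBlock b A j fun z => z ^ (-s) := by
  rw [sum_range_pow hb, LSeries.term_zero, zero_add]
  refine Finset.sum_congr rfl fun j _ => Finset.sum_congr rfl fun n hn => ?_
  have hk : 0 < b ^ j := by positivity
  have hn' := (Finset.mem_Ico.mp hn).1
  simp only [LSeries.term_of_ne_zero (show n ≠ 0 by omega), cpow_neg, div_eq_mul_inv]

/-! ### Expansion of `K` in the half-plane -/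

/-- Factor out `n` and expand in `x / n ≤ 1/2`. For `n = 1` the value `x = 1` would lie on the
circle of convergence; hence two leading digits. -/
lemma hasSum_natCast_add_cpow (s : ℂ) {n : ℕ} (hn : 2 ≤ n) {x : ℝ} (hx0 : 0 ≤ x) (hx : x ≤ 1) :
    HasSum (fun m : ℕ => (-1 : ℂ) ^ m * ((ascPochhammer ℂ m).eval s / (m.factorial : ℂ)) *
      (n : ℂ) ^ (-s - (m : ℂ)) * (x : ℂ) ^ m) (((n : ℂ) + x) ^ (-s)) := by
  have hn' : (2 : ℝ) ≤ n := by exact_mod_cast hn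
  have hn0 : (n : ℂ) ≠ 0 := by exact_mod_cast (by omega : n ≠ 0)
  have hz : ‖((x / n : ℝ) : ℂ)‖ < 1 := by
    rw [norm_real, Real.norm_of_nonneg (by positivity), div_lt_one (by positivity)]
    linarith
  have hmul : ((n : ℂ) + x) ^ (-s) = (n : ℂ) ^ (-s) * (1 + ((x / n : ℝ) : ℂ)) ^ (-s) := by
    have := mul_cpow_ofReal_nonneg (a := n) (b := 1 + x / n) (by positivity) (by positivity) (-s)
    push_cast at this ⊢
    rw [← this]
    congr 1
    field_simp
  rw [hmul]
  refine ((hasSum_one_add_cpow s hz).mul_left ((n : ℂ) ^ (-s))).congr_fun fun m => ?_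
  rw [cpow_sub _ _ hn0, cpow_natCast]
  push_cast
  rw [div_pow]
  field_simp

lemma hasSum_digitBlock (hb : 1 < b) (hA : ∀ a ∈ A, a < b) (l : ℕ) (s : ℂ) :
    HasSum (fun m : ℕ => (-1 : ℂ) ^ m * ((ascPochhammer ℂ m).eval s / (m.factorial : ℂ)) *
      twoDigitSum b A m s * uBlock b A m l s) (digitBlock b A (l + 1) fun z => z ^ (-s)) := by
  have hb0 : (b : ℂ) ≠ 0 := by exact_mod_cast (by omega : b ≠ 0)
  rw [digitBlock_succ_eq_sum_words hb hA]
  have hsum : HasSum (fun m : ℕ => ∑ a₁ ∈ A.erase 0, ∑ a₂ ∈ A,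
      ∑ w ∈ Fintype.piFinset (fun _ : Fin l => A), (b : ℂ) ^ (-((l : ℂ) * s)) *
        ((-1 : ℂ) ^ m * ((ascPochhammer ℂ m).eval s / (m.factorial : ℂ)) *
          ((a₁ * b + a₂ : ℕ) : ℂ) ^ (-s - (m : ℂ)) * (wordVal b w : ℂ) ^ m))
      (∑ a₁ ∈ A.erase 0, ∑ a₂ ∈ A, ∑ w ∈ Fintype.piFinset (fun _ : Fin l => A),
        ((b : ℂ) ^ l * (((a₁ : ℂ) * b + a₂) + wordVal b w)) ^ (-s)) := by
    refine hasSum_sum fun a₁ h₁ => hasSum_sum fun a₂ _ => hasSum_sum fun w hw => ?_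
    have h1 : 1 ≤ a₁ := Nat.one_le_iff_ne_zero.mpr (Finset.ne_of_mem_erase h₁)
    have hx0 := wordVal_nonneg b w
    have hmul : ((b : ℂ) ^ l * (((a₁ : ℂ) * b + a₂) + wordVal b w)) ^ (-s) =
        (b : ℂ) ^ (-((l : ℂ) * s)) * (((a₁ * b + a₂ : ℕ) : ℂ) + wordVal b w) ^ (-s) := by
      have := mul_cpow_ofReal_nonneg (a := (b : ℝ) ^ l) (b := (a₁ * b + a₂ : ℕ) + wordVal b w)
        (by positivity) (by positivity) (-s)
      push_cast at this ⊢
      rw [this, ← mul_neg, natCast_cpow_natCast_mul]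
    rw [hmul]
    exact (hasSum_natCast_add_cpow s (by nlinarith) hx0 (wordVal_le_one hb hA hw)).mul_left _
  refine hsum.congr_fun fun m => ?_
  rw [uBlock_eq, twoDigitSum, Finset.mul_sum (A.erase 0), Finset.sum_mul]
  refine Finset.sum_congr rfl fun a₁ _ => ?_
  rw [Finset.mul_sum A, Finset.sum_mul]
  refine Finset.sum_congr rfl fun a₂ _ => ?_
  rw [Finset.mul_sum]
  refine Finset.sum_congr rfl fun w _ => ?_
  push_cast
  ring

/-- The expansion of `K` in the half-plane of convergence. -/
lemma hasSum_K_sub_digitSum (hb : 1 < b) (hA : ∀ a ∈ A, a < b) (hA' : A.Nonempty) {s : ℂ}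
    (hs : s₀ b A < s.re) :
    HasSum (fun m : ℕ => (-1 : ℂ) ^ m * ((ascPochhammer ℂ m).eval s / (m.factorial : ℂ)) *
      twoDigitSum b A m s * u b A m s) (K b A s - digitSum A s) := by
  have hb' : (1 : ℝ) < b := by exact_mod_cast hb
  set c : ℕ → ℂ := fun m => (-1 : ℂ) ^ m * ((ascPochhammer ℂ m).eval s / (m.factorial : ℂ)) *
      twoDigitSum b A m s with hc
  have hcsum : Summable fun m => ‖c m‖ :=
    ((summable_ascPochhammer_mul_pow ‖s‖ (inv_nonneg.mpr (by positivity))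
      (inv_lt_one_of_one_lt₀ hb')).mul_left _).of_nonneg_of_le (fun _ => norm_nonneg _)
      fun m => norm_coeff_mul_twoDigitSum_le hb hA m le_rfl
  -- Dominated by a geometric series in `l` times a convergent series in `m`.
  have hdouble : Summable fun p : ℕ × ℕ => c p.2 * uBlock b A p.2 p.1 s := by
    refine ((summable_geometric_card hb hA' hs).mul_of_nonneg hcsum (fun _ => by positivity)
      fun _ => norm_nonneg _).of_norm_bounded fun p => ?_
    rw [norm_mul, mul_comm]
    exact mul_le_mul_of_nonneg_right (norm_uBlock_le hb hA _ _ _) (norm_nonneg _)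
  have hrows : HasSum (fun l => digitBlock b A (l + 1) fun z => z ^ (-s))
      (∑' p : ℕ × ℕ, c p.2 * uBlock b A p.2 p.1 s) :=
    hdouble.hasSum.prod_fiberwise fun l => hasSum_digitBlock hb hA l s
  have hswap : HasSum (fun p : ℕ × ℕ => c p.1 * uBlock b A p.1 p.2 s)
      (∑' p : ℕ × ℕ, c p.2 * uBlock b A p.2 p.1 s) :=
    (Equiv.prodComm ℕ ℕ).hasSum_iff.mp hdouble.hasSum
  have hcols : HasSum (fun m => c m * u b A m s) (∑' p : ℕ × ℕ, c p.2 * uBlock b A p.2 p.1 s) :=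
    hswap.prod_fiberwise fun m => (hasSum_uBlock hb hA hA' m hs).mul_left (c m)
  -- Partial sums cut at `b ^ k` consist of whole blocks; the block of one-digit numbers, absent
  -- from `hrows`, is the digit sum.
  have hK := (lseriesSummable_coeff hb hA hA' hs).hasSum.tendsto_sum_nat.comp
    (tendsto_pow_atTop_atTop_of_one_lt hb)
  have hK' := ((hasSum_nat_add_iff (f := fun l => digitBlock b A l fun z => z ^ (-s)) 1).mp hrows).tendsto_sum_nat
  have heq : K b A s = (∑' p : ℕ × ℕ, c p.2 * uBlock b A p.2 p.1 s) + digitSum A s := by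
    refine (tendsto_nhds_unique hK (hK'.congr fun k => (sum_range_pow_term hb s k).symm)).trans ?_
    rw [Finset.sum_range_one, digitBlock_zero hA, digitSum]
  rw [heq, add_sub_cancel_right]
  exact hcols

lemma tsum_contTerm_eq (hb : 1 < b) (hA : ∀ a ∈ A, a < b) (hA' : A.Nonempty) {s : ℂ}
    (hs : s₀ b A < s.re) :
    ∑' m, contTerm b A m s = α b A s * (K b A s - digitSum A s) := by
  rw [← ((hasSum_K_sub_digitSum hb hA hA' hs).mul_left (α b A s)).tsum_eq]
  refine tsum_congr fun m => ?_
  rw [contTerm, αu_eq_mul_uCont hb m (α_ne_zero hb hA' hs), uCont_eq_u hb hA hA' m hs]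
  ring

/-! ### Poles of the continuation -/

lemma differentiable_digitSum (A : Finset ℕ) : Differentiable ℂ (digitSum A) := by
  intro s
  refine DifferentiableAt.fun_sum fun a ha => ?_
  exact differentiableAt_id.neg.const_cpow
    (Or.inl (by exact_mod_cast Finset.ne_of_mem_erase ha))

lemma neg_one_le_meromorphicOrderAt_div_α_add (hb : 1 < b) {F G : ℂ → ℂ} (hF : Differentiable ℂ F)
    (hG : Differentiable ℂ G) (s : ℂ) :
    -1 ≤ meromorphicOrderAt (fun s => F s / α b A s + G s) s := by
  have hFa := hF.analyticAt s
  have hGa := hG.analyticAt s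
  have hα := (differentiable_α (A := A) hb).analyticAt s
  have h1 : -1 ≤ meromorphicOrderAt (F / α b A) s := by
    rw [meromorphicOrderAt_div hFa.meromorphicAt hα.meromorphicAt]
    have h0 := hFa.meromorphicOrderAt_nonneg
    have h2 := meromorphicOrderAt_α_le_one (A := A) hb s
    cases h3 : meromorphicOrderAt (α b A) s with
    | top => simp [h3] at h2
    | coe n =>
      rw [h3] at h2
      cases h4 : meromorphicOrderAt F s with
      -- Here `F` vanishes near `s`, and the quotient has order `⊤`.
      | top => simp
      | coe k =>
        rw [h4] at h0
        norm_cast at h0 h2 ⊢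
        exact WithTop.coe_le_coe.mpr (show (-1 : ℤ) ≤ k - n by omega)
  have h2 : -1 ≤ meromorphicOrderAt G s :=
    le_trans (by decide) hGa.meromorphicOrderAt_nonneg
  exact (le_min h1 h2).trans
    (meromorphicOrderAt_add (hFa.meromorphicAt.div hα.meromorphicAt) hGa.meromorphicAt)

end RestrictedDirichlet

open RestrictedDirichlet in
theorem mainTheorem2 (b : ℕ) (hb : 1 < b) (A : Finset ℕ)
    (hA : ∀ a ∈ A, a < b) (hA₁ : ∃ a ∈ A, a ≠ 0) :
    -- the series defining `K` and the `u_m` converge on the half-plane `s₀ < Re s`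
    (∀ s : ℂ, s₀ b A < s.re → LSeriesSummable (coeff b A) s) ∧
    (∀ (m : ℕ) (s : ℂ), s₀ b A < s.re → Summable (fun l : ℕ => uBlock b A m (l + 1) s)) ∧
    -- the product defining `α` converges everywhere, and `α` is entire
    (∀ s : ℂ, Multipliable (αFactor b A s)) ∧
    Differentiable ℂ (α b A) ∧
    -- `U m` is the meromorphic continuation of `u_m`, and `v m` is the entire function `α u_m`
    (∃ U v : ℕ → ℂ → ℂ,
      (∀ m : ℕ, IsMeromorphicContinuation (s₀ b A) (u b A m) (U m)) ∧
      (∀ m : ℕ, Differentiable ℂ (v m)) ∧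
      (∀ (m : ℕ) (s : ℂ), α b A s ≠ 0 →
        AnalyticAt ℂ (U m) s ∧ v m s = α b A s * U m s) ∧
      -- the series converges everywhere to an entire function `F`, which continues
      -- `α(s) (K(s) - ∑ a ^ (-s))`
      ∃ F : ℂ → ℂ,
        (∀ s : ℂ, HasSum (fun m : ℕ =>
          (-1 : ℂ) ^ m * ((ascPochhammer ℂ m).eval s / (m.factorial : ℂ)) * v m s *
            twoDigitSum b A m s) (F s)) ∧
        Differentiable ℂ F ∧
        (∀ s : ℂ, s₀ b A < s.re → F s = α b A s * (K b A s - digitSum A s))) ∧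
    -- `K` continues meromorphically; every pole is simple and is a zero of `α`
    (∃ Kc : ℂ → ℂ,
      IsMeromorphicContinuation (s₀ b A) (K b A) Kc ∧
      (∀ s : ℂ, α b A s ≠ 0 → AnalyticAt ℂ Kc s) ∧
      (∀ s : ℂ, -1 ≤ meromorphicOrderAt Kc s)) := by
  obtain ⟨a, ha, -⟩ := hA₁
  have hA' : A.Nonempty := ⟨a, ha⟩
  have hF := differentiable_tsum_contTerm hb hA
  have hα := differentiable_α (A := A) hb
  have hd := differentiable_digitSum A
  refine ⟨fun s hs => lseriesSummable_coeff hb hA hA' hs, fun m s hs => ?_,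
    multipliable_αFactor hb, hα, ?_, ?_⟩
  · exact (summable_nat_add_iff (f := fun l => uBlock b A m l s) 1).mpr (summable_uBlock hb hA hA' m hs)
  · refine ⟨uCont b A, αu b A, fun m => ⟨meromorphicOn_uCont hb m, fun s hs => ?_⟩,
      differentiable_αu hb, fun m s hs => ?_, fun s => ∑' m, contTerm b A m s, fun s => ?_, hF,
      fun s hs => ?_⟩
    · exact uCont_eq_u hb hA hA' m hs
    · exact ⟨analyticAt_uCont hb m hs, αu_eq_mul_uCont hb m hs⟩
    · exact (summable_contTerm hb hA s).hasSum
    · exact tsum_contTerm_eq hb hA hA' hs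
  -- Solve `F = α * (K - digitSum)` for `K`. The default value of the quotient at zeros of `α`
  -- affects neither meromorphy nor order.
  · refine ⟨fun s => (∑' m, contTerm b A m s) / α b A s + digitSum A s,
      ⟨fun s _ => ?_, fun s hs => ?_⟩, fun s hs => ?_,
      neg_one_le_meromorphicOrderAt_div_α_add hb hF hd⟩
    · exact ((hF.analyticAt s).meromorphicAt.div (hα.analyticAt s).meromorphicAt).add
        (hd.analyticAt s).meromorphicAt
    · simp only [tsum_contTerm_eq hb hA hA' hs]
      rw [mul_div_cancel_left₀ _ (α_ne_zero hb hA' hs), sub_add_cancel]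
    · exact ((hF.analyticAt s).div (hα.analyticAt s) hs).add (hd.analyticAt s)
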